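/- Work over $\mathbb C$. Let $x_1,\dots,x_6$ and $y_1,\dots,y_6$ be points of $\mathbb P^2$, given by homogeneous coordinate vectors in $\mathbb C^3\setminus\{0\}$, and let $Z_6$ be the $6\times 9$ matrix with rows $x_i^\top\otimes y_i^\top$. Suppose that $y_1,\dots,y_6$ lie on a line $\ell\subset\mathbb P^2$, and use homogeneous coordinates on $\ell\cong\mathbb P^1$ (any choice) to write $y_i=(y_{i1},y_{i2})$. Put $$[ij]_y=\det\begin{bmatrix}y_{i1}&y_{i2}\\y_{j1}&y_{j2}\end{bmatrix},\qquad [ijl]_x=\det\begin{bmatrix}x_i&x_j&x_l\end{bmatrix}^\top,\qquad [(ij)(kl)(rs)]_x=[ijr]_x[kls]_x-[ijs]_x[klr]_x .$$ For a function $t$ of splittings $(ij)(kl)(rs)$ of $\{1,\dots,6\}$ into ordered pairs, let $$\begin{aligned} S_1(t)&=t(25,13,46)+t(51,42,36)+t(14,35,26)+t(43,21,56)+t(32,54,16),\\ S_2(t)&=t(53,12,46)+t(14,23,56)+t(25,34,16)+t(31,45,26)+t(42,51,36),\\ S_3(t)&=t(53,41,26)+t(34,25,16)+t(42,13,56)+t(21,54,36)+t(15,32,46),\\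 S_4(t)&=t(45,31,26)+t(53,24,16)+t(41,25,36)+t(32,15,46)+t(21,43,56),\\ S_5(t)&=t(31,24,56)+t(12,53,46)+t(25,41,36)+t(54,32,16)+t(43,15,26),\\ S_6(t)&=t(42,35,16)+t(23,14,56)+t(31,52,46)+t(15,43,26)+t(54,21,36). \end{aligned}$$ Let $(\bar a_x,\bar b_x,\bar c_x,\bar d_x,\bar e_x,\bar f_x)=(S_1(t),\dots,S_6(t))$ for $t(ij,kl,rs)=[(ij)(kl)(rs)]_x$ (Coble's invariants), and let $(A_y,\dots,F_y)=(S_1(t),\dots,S_6(t))$ for $t(ij,kl,rs)=[ij]_y[kl]_y[rs]_y$ (the Joubert invariants). Then $\operatorname{rank} Z_6<6$ if and only if $$\bar a_xA_y+\bar b_xB_y+\bar c_xC_y+\bar d_xD_y+\bar e_xE_y+\bar f_xF_y=0.\tag{$*$}$$ Suppose moreover that $x_1,\dots,x_6$ are in general position (at most two of them lie on a line and at most five of them lie on a conic) and that $y_1,\dots,y_6$ are distinct. A projection $T:\mathbb P^2\dashrightarrow\ell$ is the map given by a surjective linear map from $\mathbb C^3$ to the two-dimensional subspace of $\mathbb C^3$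 corresponding to $\ell$; it is undefined exactly at its center, the point spanned by the kernel. Then $(*)$ holds if and only if there is a projection $T:\mathbb P^2\dashrightarrow\ell$ such that $T(x_i)=y_i$ for every $i$ for which $x_i$ is not the center of $T$. In particular, if there is no index $j$ and projection $T$ centered at $x_j$ with $T(x_i)=y_i$ for all $i\ne j$, then $(*)$ holds if and only if there is a projection $T$, centered at none of the $x_i$, with $T(x_i)=y_i$ for all $i$. -/

import Mathlib

namespace RankDrop

/-- The face-splitting product: the `k × 9` matrix whose `i`-th row is `x_iᵀ ⊗ y_iᵀ`. -/
def faceSplit {k : ℕ} (x y : Fin k → Fin 3 → ℂ) : Matrix (Fin k) (Fin 3 × Fin 3) ℂ :=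
  Matrix.of fun i p => x i p.1 * y i p.2

/-- `u ∼ v`: equality up to a nonzero scalar. For homogeneous coordinate vectors this says that
they represent the same projective point; if `v ≠ 0`, it forces `u ≠ 0`. -/
def SamePoint {V : Type*} [AddCommGroup V] [Module ℂ V] (u v : V) : Prop :=
  ∃ c : ℂ, c ≠ 0 ∧ u = c • v

/-- Six points of the plane are in general position: at most two of them are in a line, and at
most five of them are on a (possibly degenerate) conic. -/
def GeneralPosition (p : Fin 6 → Fin 3 → ℂ) : Prop :=
  (∀ m : Submodule ℂ (Fin 3 → ℂ), Module.finrank ℂ m = 2 → {i | p i ∈ m}.ncard ≤ 2) ∧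
  (∀ Q : QuadraticForm ℂ (Fin 3 → ℂ), Q ≠ 0 → {i | Q (p i) = 0}.ncard ≤ 5)

/-- The bracket `[ij]` of points of the projective line. -/
def bracket₂ (p : Fin 6 → Fin 2 → ℂ) (i j : Fin 6) : ℂ :=
  (Matrix.of ![p i, p j]).det

/-- The bracket `[ijl]` of points of the projective plane. -/
def bracket₃ (p : Fin 6 → Fin 3 → ℂ) (i j l : Fin 6) : ℂ :=
  (Matrix.of ![p i, p j, p l]).det

/-- The invariant `[(ij)(kl)(rs)] = [ijr][kls] - [ijs][klr]` of six points of the plane. -/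
def tripleBracket (p : Fin 6 → Fin 3 → ℂ) (i j k l r s : Fin 6) : ℂ :=
  bracket₃ p i j r * bracket₃ p k l s - bracket₃ p i j s * bracket₃ p k l r

/-- The six sums over five splittings of the labels `1, …, 6` into three pairs, shared by the
two families of invariants below; `t i j k l r s` is the summand attached to `(ij)(kl)(rs)`.
The labels are written `1, …, 6` and read in `Fin 6`, where the literal `6` is the element `0`;
so the six labels name the six elements of `Fin 6`, each exactly once. -/
def sixSums (t : Fin 6 → Fin 6 → Fin 6 → Fin 6 → Fin 6 → Fin 6 → ℂ) : Fin 6 → ℂ :=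
  ![t 2 5 1 3 4 6 + t 5 1 4 2 3 6 + t 1 4 3 5 2 6 + t 4 3 2 1 5 6 + t 3 2 5 4 1 6,
    t 5 3 1 2 4 6 + t 1 4 2 3 5 6 + t 2 5 3 4 1 6 + t 3 1 4 5 2 6 + t 4 2 5 1 3 6,
    t 5 3 4 1 2 6 + t 3 4 2 5 1 6 + t 4 2 1 3 5 6 + t 2 1 5 4 3 6 + t 1 5 3 2 4 6,
    t 4 5 3 1 2 6 + t 5 3 2 4 1 6 + t 4 1 2 5 3 6 + t 3 2 1 5 4 6 + t 2 1 4 3 5 6,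
    t 3 1 2 4 5 6 + t 1 2 5 3 4 6 + t 2 5 4 1 3 6 + t 5 4 3 2 1 6 + t 4 3 1 5 2 6,
    t 4 2 3 5 1 6 + t 2 3 1 4 5 6 + t 3 1 5 2 4 6 + t 1 5 4 3 2 6 + t 5 4 2 1 3 6]

/-- Coble's invariants `(a̅, b̅, c̅, d̅, e̅, f̅)` of six points of the plane. -/
def cobleInvariants (p : Fin 6 → Fin 3 → ℂ) : Fin 6 → ℂ :=
  sixSums (tripleBracket p)

/-- The Joubert invariants `(A, B, C, D, E, F)` of six points of the projective line. -/
def joubertInvariants (p : Fin 6 → Fin 2 → ℂ) : Fin 6 → ℂ :=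
  sixSums fun i j k l r s => bracket₂ p i j * bracket₂ p k l * bracket₂ p r s

end RankDrop

open RankDrop

open RankDrop

namespace RankDrop

/-! Since all `y i` lie in `ℓ`, the rows `x i ⊗ y i` live in the six-dimensional space `ℂ³ ⊗ ℓ`, so
the rank drops exactly when one `6 × 6` determinant vanishes (`rank_faceSplit_lt_iff`). Its Laplace
expansion involves products of two complementary brackets of `x`; the Plücker relations reduce these
to five, and comparing coefficients identifies the determinant with the Coble–Joubert pairing up to
the factor `-24` (`sum_coble_mul_joubert`). A kernel vector of the same matrix is a bilinear form on
`ℂ³ × ℓ` vanishing at every `(x i, y i)`; through the area form on `ℓ` it becomes a nonzero map `T`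
with each `T (x i)` proportional to `y i` (`det_eq_zero_iff_exists_linearMap`). General position
makes `T` surjective (`GeneralPosition.surjective`) and lets it kill at most one `x i`
(`GeneralPosition.eq_of_map_eq_zero`). -/

/-- The `6 × 6` matrix whose `i`-th row lists the coordinates of `x i ⊗ y i`. -/
def planeLineMatrix (x : Fin 6 → Fin 3 → ℂ) (y : Fin 6 → Fin 2 → ℂ) : Matrix (Fin 6) (Fin 6) ℂ :=
  Matrix.of fun i => ![x i 0 * y i 0, x i 1 * y i 0, x i 2 * y i 0,
    x i 0 * y i 1, x i 1 * y i 1, x i 2 * y i 1]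

/-! ### The determinant as a pairing of invariants -/

theorem bracket₂_eq (p : Fin 6 → Fin 2 → ℂ) (i j : Fin 6) :
    bracket₂ p i j = p i 0 * p j 1 - p i 1 * p j 0 := by
  simp [bracket₂, Matrix.det_fin_two]

theorem bracket₃_eq (p : Fin 6 → Fin 3 → ℂ) (i j l : Fin 6) :
    bracket₃ p i j l = p i 0 * (p j 1 * p l 2 - p j 2 * p l 1)
      - p i 1 * (p j 0 * p l 2 - p j 2 * p l 0) + p i 2 * (p j 0 * p l 1 - p j 1 * p l 0) := by
  simp [bracket₃, Matrix.det_fin_three]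
  ring

theorem det_fin_four (A : Matrix (Fin 4) (Fin 4) ℂ) :
    A.det =
      A 0 0 * (A 1 1 * (A 2 2 * A 3 3 - A 2 3 * A 3 2) - A 1 2 * (A 2 1 * A 3 3 - A 2 3 * A 3 1)
        + A 1 3 * (A 2 1 * A 3 2 - A 2 2 * A 3 1))
      - A 0 1 * (A 1 0 * (A 2 2 * A 3 3 - A 2 3 * A 3 2) - A 1 2 * (A 2 0 * A 3 3 - A 2 3 * A 3 0)
        + A 1 3 * (A 2 0 * A 3 2 - A 2 2 * A 3 0))
      + A 0 2 * (A 1 0 * (A 2 1 * A 3 3 - A 2 3 * A 3 1) - A 1 1 * (A 2 0 * A 3 3 - A 2 3 * A 3 0)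
        + A 1 3 * (A 2 0 * A 3 1 - A 2 1 * A 3 0))
      - A 0 3 * (A 1 0 * (A 2 1 * A 3 2 - A 2 2 * A 3 1) - A 1 1 * (A 2 0 * A 3 2 - A 2 2 * A 3 0)
        + A 1 2 * (A 2 0 * A 3 1 - A 2 1 * A 3 0)) := by
  rw [Matrix.det_succ_row_zero]
  simp [Fin.sum_univ_succ, Matrix.det_fin_three, Fin.succAbove]
  ring

/-- The Laplace expansion of `planeLineMatrix` along its two blocks of columns. -/
theorem det_planeLineMatrix (x : Fin 6 → Fin 3 → ℂ) (y : Fin 6 → Fin 2 → ℂ) :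
    (planeLineMatrix x y).det =
      bracket₃ x 0 1 2 * bracket₃ x 3 4 5 *
        (y 0 0 * y 1 0 * y 2 0 * y 3 1 * y 4 1 * y 5 1
          - y 0 1 * y 1 1 * y 2 1 * y 3 0 * y 4 0 * y 5 0)
      - bracket₃ x 0 1 3 * bracket₃ x 2 4 5 *
        (y 0 0 * y 1 0 * y 3 0 * y 2 1 * y 4 1 * y 5 1
          - y 0 1 * y 1 1 * y 3 1 * y 2 0 * y 4 0 * y 5 0)
      + bracket₃ x 0 1 4 * bracket₃ x 2 3 5 *
        (y 0 0 * y 1 0 * y 4 0 * y 2 1 * y 3 1 * y 5 1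
          - y 0 1 * y 1 1 * y 4 1 * y 2 0 * y 3 0 * y 5 0)
      - bracket₃ x 0 1 5 * bracket₃ x 2 3 4 *
        (y 0 0 * y 1 0 * y 5 0 * y 2 1 * y 3 1 * y 4 1
          - y 0 1 * y 1 1 * y 5 1 * y 2 0 * y 3 0 * y 4 0)
      + bracket₃ x 0 2 3 * bracket₃ x 1 4 5 *
        (y 0 0 * y 2 0 * y 3 0 * y 1 1 * y 4 1 * y 5 1
          - y 0 1 * y 2 1 * y 3 1 * y 1 0 * y 4 0 * y 5 0)
      - bracket₃ x 0 2 4 * bracket₃ x 1 3 5 *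
        (y 0 0 * y 2 0 * y 4 0 * y 1 1 * y 3 1 * y 5 1
          - y 0 1 * y 2 1 * y 4 1 * y 1 0 * y 3 0 * y 5 0)
      + bracket₃ x 0 2 5 * bracket₃ x 1 3 4 *
        (y 0 0 * y 2 0 * y 5 0 * y 1 1 * y 3 1 * y 4 1
          - y 0 1 * y 2 1 * y 5 1 * y 1 0 * y 3 0 * y 4 0)
      + bracket₃ x 0 3 4 * bracket₃ x 1 2 5 *
        (y 0 0 * y 3 0 * y 4 0 * y 1 1 * y 2 1 * y 5 1
          - y 0 1 * y 3 1 * y 4 1 * y 1 0 * y 2 0 * y 5 0)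
      - bracket₃ x 0 3 5 * bracket₃ x 1 2 4 *
        (y 0 0 * y 3 0 * y 5 0 * y 1 1 * y 2 1 * y 4 1
          - y 0 1 * y 3 1 * y 5 1 * y 1 0 * y 2 0 * y 4 0)
      + bracket₃ x 0 4 5 * bracket₃ x 1 2 3 *
        (y 0 0 * y 4 0 * y 5 0 * y 1 1 * y 2 1 * y 3 1
          - y 0 1 * y 4 1 * y 5 1 * y 1 0 * y 2 0 * y 3 0) := by
  rw [Matrix.det_succ_row_zero]
  simp only [Matrix.det_succ_row_zero (n := 4), det_fin_four]
  simp [bracket₃_eq, planeLineMatrix, Fin.sum_univ_succ, Fin.succAbove]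
  ring

/-- This and the next four are Plücker relations: they straighten the nonstandard tableaux. -/
theorem bracket₃_mul_015 (x : Fin 6 → Fin 3 → ℂ) :
    bracket₃ x 0 1 5 * bracket₃ x 2 3 4 = (bracket₃ x 0 1 2 * bracket₃ x 3 4 5) - (bracket₃ x 0 1
      3 * bracket₃ x 2 4 5) + (bracket₃ x 0 1 4 * bracket₃ x 2 3 5) := by
  simp only [bracket₃_eq]
  ring

theorem bracket₃_mul_025 (x : Fin 6 → Fin 3 → ℂ) :
    bracket₃ x 0 2 5 * bracket₃ x 1 3 4 = -(bracket₃ x 0 1 2 * bracket₃ x 3 4 5) - (bracket₃ x 0 2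
      3 * bracket₃ x 1 4 5) + (bracket₃ x 0 2 4 * bracket₃ x 1 3 5) := by
  simp only [bracket₃_eq]
  ring

theorem bracket₃_mul_034 (x : Fin 6 → Fin 3 → ℂ) :
    bracket₃ x 0 3 4 * bracket₃ x 1 2 5 = -(bracket₃ x 0 1 2 * bracket₃ x 3 4 5) + (bracket₃ x 0 1
      3 * bracket₃ x 2 4 5) - (bracket₃ x 0 1 4 * bracket₃ x 2 3 5) - (bracket₃ x 0 2 3 * bracket₃
      x 1 4 5) + (bracket₃ x 0 2 4 * bracket₃ x 1 3 5) := by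
  simp only [bracket₃_eq]
  ring

theorem bracket₃_mul_035 (x : Fin 6 → Fin 3 → ℂ) :
    bracket₃ x 0 3 5 * bracket₃ x 1 2 4 = -(bracket₃ x 0 1 2 * bracket₃ x 3 4 5) - (bracket₃ x 0 1
      4 * bracket₃ x 2 3 5) + (bracket₃ x 0 2 4 * bracket₃ x 1 3 5) := by
  simp only [bracket₃_eq]
  ring

theorem bracket₃_mul_045 (x : Fin 6 → Fin 3 → ℂ) :
    bracket₃ x 0 4 5 * bracket₃ x 1 2 3 = (bracket₃ x 0 1 2 * bracket₃ x 3 4 5) - (bracket₃ x 0 1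
      3 * bracket₃ x 2 4 5) + (bracket₃ x 0 2 3 * bracket₃ x 1 4 5) := by
  simp only [bracket₃_eq]
  ring

/-- Coble's invariants in the basis of products of brackets given by the standard tableaux. -/
theorem cobleInvariants_eq (x : Fin 6 → Fin 3 → ℂ) :
    cobleInvariants x =
      ![6 * (bracket₃ x 0 1 2 * bracket₃ x 3 4 5) - 4 * (bracket₃ x 0 1 3 * bracket₃ x 2 4 5) + 2 *
          (bracket₃ x 0 1 4 * bracket₃ x 2 3 5) + 2 * (bracket₃ x 0 2 3 * bracket₃ x 1 4 5) - 4 *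
          (bracket₃ x 0 2 4 * bracket₃ x 1 3 5),
        2 * (bracket₃ x 0 1 3 * bracket₃ x 2 4 5) - 4 * (bracket₃ x 0 1 4 * bracket₃ x 2 3 5) + 2 *
          (bracket₃ x 0 2 3 * bracket₃ x 1 4 5) + 2 * (bracket₃ x 0 2 4 * bracket₃ x 1 3 5),
        -4 * (bracket₃ x 0 1 3 * bracket₃ x 2 4 5) + 2 * (bracket₃ x 0 1 4 * bracket₃ x 2 3 5) + 2 *
          (bracket₃ x 0 2 3 * bracket₃ x 1 4 5) + 2 * (bracket₃ x 0 2 4 * bracket₃ x 1 3 5),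
        -6 * (bracket₃ x 0 1 2 * bracket₃ x 3 4 5) + 2 * (bracket₃ x 0 1 3 * bracket₃ x 2 4 5) - 4 *
          (bracket₃ x 0 1 4 * bracket₃ x 2 3 5) - 4 * (bracket₃ x 0 2 3 * bracket₃ x 1 4 5) + 2 *
          (bracket₃ x 0 2 4 * bracket₃ x 1 3 5),
        2 * (bracket₃ x 0 1 3 * bracket₃ x 2 4 5) + 2 * (bracket₃ x 0 1 4 * bracket₃ x 2 3 5) + 2 *
          (bracket₃ x 0 2 3 * bracket₃ x 1 4 5) - 4 * (bracket₃ x 0 2 4 * bracket₃ x 1 3 5),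
        2 * (bracket₃ x 0 1 3 * bracket₃ x 2 4 5) + 2 * (bracket₃ x 0 1 4 * bracket₃ x 2 3 5) - 4 *
          (bracket₃ x 0 2 3 * bracket₃ x 1 4 5) + 2 * (bracket₃ x 0 2 4 * bracket₃ x 1 3 5)] := by
  ext n
  fin_cases n <;> simp [cobleInvariants, sixSums, tripleBracket, bracket₃_eq] <;> ring

/-- The pairing of the Coble and the Joubert invariants is, up to a constant, a determinant. -/
theorem sum_coble_mul_joubert (x : Fin 6 → Fin 3 → ℂ) (y : Fin 6 → Fin 2 → ℂ) :
    ∑ n, cobleInvariants x n * joubertInvariants y n = -24 * (planeLineMatrix x y).det := by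
  -- The brackets of `x` stay closed, so `ring` compares coefficients of the five standard products
  -- as polynomials in `y` alone.
  rw [det_planeLineMatrix, bracket₃_mul_015, bracket₃_mul_025, bracket₃_mul_034,
    bracket₃_mul_035, bracket₃_mul_045, cobleInvariants_eq]
  simp only [joubertInvariants, sixSums, Fin.sum_univ_six, Matrix.cons_val, bracket₂_eq,
    show (6 : Fin 6) = 0 from rfl]
  ring

/-! ### Row dependences and kernel vectors -/

theorem rank_lt_card_iff_exists_vecMul {K m n : Type*} [Field K] [Fintype m] [Fintype n]
    (A : Matrix m n K) :
    A.rank < Fintype.card m ↔ ∃ c : m → K, c ≠ 0 ∧ Matrix.vecMul c A = 0 := by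
  have hle : A.rank ≤ Fintype.card m := A.rank_le_card_height
  have h : LinearIndependent K A.row ↔ Fintype.card m = A.rank := by
    rw [Matrix.rank_eq_finrank_span_row, linearIndependent_iff_card_eq_finrank_span, Set.finrank]
  have hker : LinearIndependent K A.row ↔ ∀ c, Matrix.vecMul c A = 0 → c = 0 := by
    rw [← Matrix.vecMul_injective_iff, ← Matrix.coe_vecMulLinear,
      injective_iff_map_eq_zero A.vecMulLinear]
    rfl
  rw [lt_iff_le_and_ne, and_iff_right hle, ne_comm, ne_eq, ← h, hker]
  push Not
  exact exists_congr fun _ => and_comm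

/-- Passing to coordinates on the line does not change the row dependences. -/
theorem rank_faceSplit_lt_iff (x y : Fin 6 → Fin 3 → ℂ)
    (ℓ : Submodule ℂ (Fin 3 → ℂ)) (hyℓ : ∀ i, y i ∈ ℓ) (φ : ℓ ≃ₗ[ℂ] (Fin 2 → ℂ)) :
    (faceSplit x y).rank < 6 ↔ (planeLineMatrix x fun i => φ ⟨y i, hyℓ i⟩).det = 0 := by
  have hcard := rank_lt_card_iff_exists_vecMul (faceSplit x y)
  rw [Fintype.card_fin] at hcard
  rw [hcard, ← Matrix.exists_vecMul_eq_zero_iff]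
  refine exists_congr fun c => and_congr_right fun _ => ?_
  -- Both systems of equations are coordinates of the same three vectors of `ℓ`: nine in `ℂ³`, six
  -- through `φ`.
  trans ∀ a, ∑ i, (c i * x i a) • (⟨y i, hyℓ i⟩ : ℓ) = 0
  · simp only [funext_iff, Prod.forall, Subtype.ext_iff]
    refine forall_congr' fun a => forall_congr' fun b => ?_
    simp [Matrix.vecMul, dotProduct, faceSplit, mul_assoc]
  · have h : ∀ a, ∑ i, (c i * x i a) • (⟨y i, hyℓ i⟩ : ℓ) = 0 ↔
        ∀ b, ∑ i, c i * (x i a * φ ⟨y i, hyℓ i⟩ b) = 0 := fun a => by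
      rw [← φ.map_eq_zero_iff, map_sum, funext_iff]
      simp only [map_smul, Finset.sum_apply, Pi.smul_apply, smul_eq_mul, mul_assoc, Pi.zero_apply]
    simp only [h, funext_iff, Fin.forall_fin_succ]
    simp [Matrix.vecMul, dotProduct, planeLineMatrix]
    tauto

/-- `planeLineMatrix` is singular iff some nonzero linear map sends each `x i` into the span of
`y i`. -/
theorem det_planeLineMatrix_eq_zero_iff (x : Fin 6 → Fin 3 → ℂ) (y : Fin 6 → Fin 2 → ℂ) :
    (planeLineMatrix x y).det = 0 ↔ ∃ T : (Fin 3 → ℂ) →ₗ[ℂ] (Fin 2 → ℂ), T ≠ 0 ∧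
      ∀ i, T (x i) 0 * y i 1 = T (x i) 1 * y i 0 := by
  rw [← Matrix.exists_mulVec_eq_zero_iff]
  constructor
  · rintro ⟨v, hv, h⟩
    -- Row `i` times `v` is `y₀ p(x) + y₁ q(x)` with `p`, `q` the two halves of `v`; this is the
    -- cross product of `(q, -p)(x)` with `y`.
    refine ⟨Matrix.toLin' !![v 3, v 4, v 5; -v 0, -v 1, -v 2], ?_, fun i => ?_⟩
    · contrapose! hv
      rw [LinearEquiv.map_eq_zero_iff, ← Matrix.ext_iff] at hv
      simp [Fin.forall_fin_succ] at hv
      ext i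
      fin_cases i <;> simp [hv]
    · have := congrFun h i
      simp [Matrix.mulVec, dotProduct, planeLineMatrix, Fin.sum_univ_succ] at this ⊢
      linear_combination this
  · rintro ⟨T, hT, h⟩
    obtain ⟨A, rfl⟩ := Matrix.toLin'.surjective T
    refine ⟨![-A 1 0, -A 1 1, -A 1 2, A 0 0, A 0 1, A 0 2], ?_, ?_⟩
    · contrapose! hT
      rw [LinearEquiv.map_eq_zero_iff]
      simp [funext_iff, Fin.forall_fin_succ] at hT
      ext i j
      fin_cases i <;> fin_cases j <;> simp [hT]
    · ext i
      have := h i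
      simp [Matrix.mulVec, dotProduct, planeLineMatrix, Fin.sum_univ_succ] at this ⊢
      linear_combination this

theorem exists_eq_smul_of_cross_eq {u v : Fin 2 → ℂ} (hv : v ≠ 0) (h : u 0 * v 1 = u 1 * v 0) :
    ∃ c : ℂ, u = c • v := by
  by_cases h0 : v 0 = 0
  · have h1 : v 1 ≠ 0 := fun h1 => hv (by ext i; fin_cases i <;> simp [h0, h1])
    refine ⟨u 1 / v 1, ?_⟩
    ext i
    fin_cases i
    · simp_all
    · simp [h1]
  · refine ⟨u 0 / v 0, ?_⟩
    ext i
    fin_cases i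
    · simp [h0]
    · simp
      field_simp
      linear_combination -h

/-- The same criterion with values in the line itself. -/
theorem det_eq_zero_iff_exists_linearMap (x : Fin 6 → Fin 3 → ℂ) {ℓ : Type*} [AddCommGroup ℓ]
    [Module ℂ ℓ] (φ : ℓ ≃ₗ[ℂ] (Fin 2 → ℂ)) (y : Fin 6 → ℓ) (hy : ∀ i, y i ≠ 0) :
    (planeLineMatrix x fun i => φ (y i)).det = 0 ↔ ∃ T : (Fin 3 → ℂ) →ₗ[ℂ] ℓ, T ≠ 0 ∧
      ∀ i, T (x i) ≠ 0 → SamePoint (T (x i)) (y i) := by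
  rw [det_planeLineMatrix_eq_zero_iff]
  constructor
  · rintro ⟨T, hT, h⟩
    refine ⟨φ.symm.toLinearMap ∘ₗ T, fun h0 => hT ?_, fun i hi => ?_⟩
    · refine LinearMap.ext fun v => ?_
      simpa using LinearMap.congr_fun h0 v
    · obtain ⟨c, hc⟩ := exists_eq_smul_of_cross_eq
        (fun h0 => hy i (φ.map_eq_zero_iff.1 h0)) (h i)
      have hc' : (φ.symm.toLinearMap ∘ₗ T) (x i) = c • y i := by simp [hc]
      exact ⟨c, fun h0 => hi (by rw [hc', h0, zero_smul]), hc'⟩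
  · rintro ⟨T, hT, h⟩
    refine ⟨φ.toLinearMap ∘ₗ T, fun h0 => hT ?_, fun i => ?_⟩
    · refine LinearMap.ext fun v => ?_
      simpa using LinearMap.congr_fun h0 v
    · by_cases hi : T (x i) = 0
      · simp [hi]
      · obtain ⟨c, -, hc⟩ := h i hi
        simp [hc]
        ring

/-! ### Surjectivity and center of the projection -/

/-- Three points in general position are not on a line. -/
theorem GeneralPosition.not_collinear {x : Fin 6 → Fin 3 → ℂ} (hx : GeneralPosition x)
    {f : (Fin 3 → ℂ) →ₗ[ℂ] ℂ} (hf : f ≠ 0) {i j k : Fin 6} (hij : i ≠ j) (hik : i ≠ k)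
    (hjk : j ≠ k) (hi : f (x i) = 0) (hj : f (x j) = 0) (hk : f (x k) = 0) : False := by
  have hker : Module.finrank ℂ (LinearMap.ker f) = 2 := by
    have h := f.finrank_range_add_finrank_ker
    rw [LinearMap.range_eq_top.2 (LinearMap.surjective hf)] at h
    simp at h
    omega
  have hle := hx.1 (LinearMap.ker f) hker
  have hsub : ({i, j, k} : Set (Fin 6)) ⊆ {i | x i ∈ LinearMap.ker f} := by
    rintro _ (rfl | rfl | rfl) <;> simpa
  have := Set.ncard_le_ncard hsub
  rw [Set.ncard_eq_three.2 ⟨i, j, k, hij, hik, hjk, rfl⟩] at this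
  omega

theorem SamePoint.symm {V : Type*} [AddCommGroup V] [Module ℂ V] {u v : V}
    (h : SamePoint u v) : SamePoint v u := by
  obtain ⟨c, hc, rfl⟩ := h
  exact ⟨c⁻¹, inv_ne_zero hc, (inv_smul_smul₀ hc v).symm⟩

theorem SamePoint.trans {V : Type*} [AddCommGroup V] [Module ℂ V] {u v w : V}
    (h : SamePoint u v) (h' : SamePoint v w) : SamePoint u w := by
  obtain ⟨c, hc, rfl⟩ := h
  obtain ⟨d, hd, rfl⟩ := h'
  exact ⟨c * d, mul_ne_zero hc hd, (mul_smul _ _ _).symm⟩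

/-- A nonzero linear map which respects distinct points on a line is surjective. -/
theorem GeneralPosition.surjective {x : Fin 6 → Fin 3 → ℂ} (hx : GeneralPosition x)
    {ℓ : Type*} [AddCommGroup ℓ] [Module ℂ ℓ] (hℓ : Module.finrank ℂ ℓ = 2) {y : Fin 6 → ℓ}
    (hy : ∀ i j, i ≠ j → ¬ SamePoint (y i) (y j)) {T : (Fin 3 → ℂ) →ₗ[ℂ] ℓ} (hT : T ≠ 0)
    (h : ∀ i, T (x i) ≠ 0 → SamePoint (T (x i)) (y i)) : Function.Surjective T := by
  have : FiniteDimensional ℂ ℓ := .of_finrank_pos (by omega)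
  by_contra hsurj
  have hrange : Module.finrank ℂ (LinearMap.range T) ≤ 1 := by
    have := Submodule.finrank_lt fun h => hsurj (LinearMap.range_eq_top.1 h)
    omega
  obtain ⟨w, hw⟩ := finrank_le_one_iff.1 hrange
  have hw' : ∀ v, ∃ c : ℂ, c • (w : ℓ) = T v := fun v => by
    obtain ⟨c, hc⟩ := hw ⟨T v, v, rfl⟩
    exact ⟨c, congrArg Subtype.val hc⟩
  -- The image is at most a single projective point, so two nonzero values would identify two of the
  -- distinct `y i`.
  have hone : ∀ i j, T (x i) ≠ 0 → T (x j) ≠ 0 → i = j := by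
    intro i j hi hj
    by_contra hij
    refine hy i j hij ((h i hi).symm.trans (SamePoint.trans ?_ (h j hj)))
    obtain ⟨c, hc⟩ := hw' (x i)
    obtain ⟨d, hd⟩ := hw' (x j)
    have hc0 : c ≠ 0 := fun h0 => hi (by rw [← hc, h0, zero_smul])
    have hd0 : d ≠ 0 := fun h0 => hj (by rw [← hd, h0, zero_smul])
    exact ⟨c * d⁻¹, by simp [hc0, hd0], by rw [← hc, ← hd, mul_smul, inv_smul_smul₀ hd0]⟩
  obtain ⟨i₀, hi₀⟩ : ∃ i₀, ∀ i, i ≠ i₀ → T (x i) = 0 := by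
    by_cases hex : ∃ i, T (x i) ≠ 0
    · obtain ⟨i₀, h0⟩ := hex
      exact ⟨i₀, fun i hi => by_contra fun h1 => hi (hone i i₀ h1 h0)⟩
    · push Not at hex
      exact ⟨0, fun i _ => hex i⟩
  obtain ⟨v, hv⟩ : ∃ v, T v ≠ 0 := by
    contrapose! hT
    exact LinearMap.ext hT
  obtain ⟨g, hg⟩ : ∃ g : Module.Dual ℂ ℓ, g (T v) ≠ 0 := by
    contrapose! hv
    exact (Module.forall_dual_apply_eq_zero_iff ℂ _).1 hv
  obtain ⟨i, j, k, hij, hik, hjk, hi, hj, hk⟩ : ∃ i j k : Fin 6,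
      i ≠ j ∧ i ≠ k ∧ j ≠ k ∧ i ≠ i₀ ∧ j ≠ i₀ ∧ k ≠ i₀ := by
    clear * -
    decide +revert
  -- All points but `i₀` lie in `ker T`, hence on the line `g ∘ T = 0`.
  exact hx.not_collinear (f := g ∘ₗ T) (fun h0 => hg (LinearMap.congr_fun h0 v)) hij hik hjk
    (by simp [hi₀ i hi]) (by simp [hi₀ j hj]) (by simp [hi₀ k hk])

/-- The center of a projection is at most one of several points in general position. -/
theorem GeneralPosition.eq_of_map_eq_zero {x : Fin 6 → Fin 3 → ℂ} (hx : GeneralPosition x)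
    {ℓ : Type*} [AddCommGroup ℓ] [Module ℂ ℓ] (hℓ : Module.finrank ℂ ℓ = 2)
    {T : (Fin 3 → ℂ) →ₗ[ℂ] ℓ} (hT : Function.Surjective T) {i j : Fin 6}
    (hi : T (x i) = 0) (hj : T (x j) = 0) : i = j := by
  by_contra hij
  obtain ⟨k, hik, hjk⟩ : ∃ k : Fin 6, i ≠ k ∧ j ≠ k := by
    clear * -
    decide +revert
  -- A functional `g` killing `T (x k)` pulls back to a line through the center and `x k`, which
  -- contains `x i`, `x j` and `x k`.
  have hlt : Submodule.span ℂ {T (x k)} < ⊤ := by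
    refine lt_top_iff_ne_top.2 fun htop => ?_
    have h1 := (finrank_span_le_card (R := ℂ) {T (x k)}).trans_eq (Set.toFinset_card _)
    rw [htop, finrank_top, Fintype.card_unique] at h1
    omega
  obtain ⟨g, hg, hle⟩ := Submodule.exists_le_ker_of_lt_top _ hlt
  refine hx.not_collinear (f := g ∘ₗ T) (fun h0 => hg (LinearMap.ext fun w => ?_)) hij hik hjk
    (by simp [hi]) (by simp [hj]) (hle (Submodule.mem_span_singleton_self _))
  obtain ⟨v, rfl⟩ := hT w
  exact LinearMap.congr_fun h0 v

end RankDrop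

/-- Points of the plane are given by homogeneous coordinates `x i`, `y i`. A line of the plane is
a two-dimensional subspace `ℓ` of `ℂ³`; `φ` is an arbitrary choice of homogeneous coordinates on
it. A projection from the plane to the line is a surjective linear map `T` from `ℂ³` to `ℓ`; it is
undefined exactly at its center, the point spanned by the kernel of `T`. -/
theorem theorem6p7 (x y : Fin 6 → Fin 3 → ℂ) (hx : ∀ i, x i ≠ 0) (hy : ∀ i, y i ≠ 0)
    (ℓ : Submodule ℂ (Fin 3 → ℂ)) (hℓ : Module.finrank ℂ ℓ = 2) (hyℓ : ∀ i, y i ∈ ℓ)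
    (φ : ℓ ≃ₗ[ℂ] (Fin 2 → ℂ)) :
    ((faceSplit x y).rank < 6 ↔
      ∑ n, cobleInvariants x n * joubertInvariants (fun i => φ ⟨y i, hyℓ i⟩) n = 0) ∧
    (GeneralPosition x → (∀ i j, i ≠ j → ¬ SamePoint (y i) (y j)) →
      (∑ n, cobleInvariants x n * joubertInvariants (fun i => φ ⟨y i, hyℓ i⟩) n = 0 ↔
        ∃ T : (Fin 3 → ℂ) →ₗ[ℂ] ℓ, Function.Surjective T ∧
          ∀ i, T (x i) ≠ 0 → SamePoint (T (x i)) ⟨y i, hyℓ i⟩) ∧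
      ((¬ ∃ (j : Fin 6) (T : (Fin 3 → ℂ) →ₗ[ℂ] ℓ), Function.Surjective T ∧ T (x j) = 0 ∧
          ∀ i, i ≠ j → SamePoint (T (x i)) ⟨y i, hyℓ i⟩) →
        (∑ n, cobleInvariants x n * joubertInvariants (fun i => φ ⟨y i, hyℓ i⟩) n = 0 ↔
          ∃ T : (Fin 3 → ℂ) →ₗ[ℂ] ℓ, Function.Surjective T ∧
            ∀ i, SamePoint (T (x i)) ⟨y i, hyℓ i⟩))) := by
  have hdet : ∑ n, cobleInvariants x n * joubertInvariants (fun i => φ ⟨y i, hyℓ i⟩) n = 0 ↔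
      (planeLineMatrix x fun i => φ ⟨y i, hyℓ i⟩).det = 0 := by
    rw [sum_coble_mul_joubert]
    simp
  refine ⟨by rw [hdet, rank_faceSplit_lt_iff], fun hgp hdist => ?_⟩
  have hdist' : ∀ i j, i ≠ j → ¬ SamePoint (⟨y i, hyℓ i⟩ : ℓ) ⟨y j, hyℓ j⟩ := by
    rintro i j hij ⟨c, hc, h⟩
    exact hdist i j hij ⟨c, hc, congrArg Subtype.val h⟩
  have hproj : ∑ n, cobleInvariants x n * joubertInvariants (fun i => φ ⟨y i, hyℓ i⟩) n = 0 ↔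
      ∃ T : (Fin 3 → ℂ) →ₗ[ℂ] ℓ, Function.Surjective T ∧
        ∀ i, T (x i) ≠ 0 → SamePoint (T (x i)) ⟨y i, hyℓ i⟩ := by
    rw [hdet, det_eq_zero_iff_exists_linearMap x φ _
      fun i h0 => hy i (congrArg Subtype.val h0)]
    refine exists_congr fun T => and_congr_left fun h =>
      ⟨fun hT => hgp.surjective hℓ hdist' hT h, ?_⟩
    rintro hT rfl
    have := hℓ ▸ finrank_top ℂ ℓ
    rw [← LinearMap.range_eq_top.2 hT, LinearMap.range_zero, finrank_bot] at this
    omega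
  refine ⟨hproj, fun hcenter => hproj.trans ⟨?_, ?_⟩⟩
  · rintro ⟨T, hT, h⟩
    -- If `T` killed `x i`, it would kill no other point and so be a projection centered at `x i`,
    -- excluded by `hcenter`.
    refine ⟨T, hT, fun i => h i fun hi => hcenter ⟨i, T, hT, hi, fun j hj => h j fun hj0 => ?_⟩⟩
    exact hj (hgp.eq_of_map_eq_zero hℓ hT hj0 hi)
  · rintro ⟨T, hT, h⟩
    exact ⟨T, hT, fun i _ => h i⟩
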